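/- **Setting.** Let $L\ge 1$ and $n\ge 0$ be integers and let $f(X,\theta)=g_L(\sigma(\cdots g_2(\sigma(g_1(X,\theta)))\cdots))$, with $\sigma$ acting componentwise, be one of the following networks, where $\theta\in\mathbb R^P$ is the vector of all weights and biases ($W_i$, $B_i$, $1\le i\le L$). 1. (DNN) $f:\mathbb R^{N_0}\times\mathbb R^P\to\mathbb R^{M}$, $M=N_L$, with $g_i(X,\theta)=W_iX+B_i$, $W_i\in\mathbb R^{N_i\times N_{i-1}}$, $B_i\in\mathbb R^{N_i}$; assume $P=\sum_{i=1}^L N_i(N_{i-1}+1)\ge nM$. 2. (ResNet) $f:\mathbb R^{N}\times\mathbb R^P\to\mathbb R^{N}$ with $g_i(X,\theta)=X+W_iX+B_i$, $W_i\in\mathbb R^{N\times N}$, $B_i\in\mathbb R^N$; assume $P=L(N^2+N)\ge nN$. 3. (GCN) $f:\mathbb R^{m\times N_0}\times\mathbb R^P\to\mathbb R^{m\times M}$, $M=N_L$, with $g_i(X,\theta)=\hat D^{s}\hat A\hat D^{s}XW_i+B_i$, $W_i\in\mathbb R^{N_{i-1}\times N_i}$, $B_i\in\mathbb R^{m\times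 N_i}$, where $\hat A=A+\mathbb I_m$ for the adjacency matrix $A$ of a simple graph on $m$ vertices, $\hat D$ is the diagonal matrix of the row sums of $\hat A$, and $s$ is a fixed real number (for instance $s=\tfrac12$, or $s=-\tfrac12$ for the symmetrically normalized adjacency matrix); assume $P=\sum_{i=1}^L N_i(N_{i-1}+m)\ge nmM$. The activation $\sigma:\mathbb R\to\mathbb R$ is either a continuous, piecewise polynomial function (with finitely many closed pieces) that is zero at finitely many points only (such as leaky or parametric ReLU), or the ReLU $x\mapsto\max(x,0)$, or the sigmoid $x\mapsto 1/(1+e^{-x})$. Let $y_1,\dots,y_n$ be arbitrary fixed labels in the output space, and let the initialization $\theta_0$ and the inputs $X_1,\dots,X_n$ be random, with a joint law that is absolutely continuous with respect to Lebesgue measure. Let $\mathcal L(\theta)=\frac12\sum_{j=1}^n\|f(X_j,\theta)-y_j\|^2$ (Euclidean norms). A *gradient flow* of $\mathcal L$ on $[0,T]$ started at $\theta_0$ is an absolutely continuous curve $\theta:[0,T]\to\mathbb R^P$ with $\theta(0)=\theta_0$ and $-\theta'(t)\in\partial\mathcal L(\theta(t))$ for almost every $t\in[0,T]$. Here $\partial\mathcal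 L$ is Clarke's generalized gradient: $\xi\in\partial\mathcal L(x)$ iff $\langle\xi,v\rangle\le\limsup_{z\to x,\,s\downarrow0}\frac{\mathcal L(z+sv)-\mathcal L(z)}{s}$ for all $v$. Thus $\theta'=-\nabla\mathcal L(\theta)$ wherever $\mathcal L$ is continuously differentiable. **Corollary (linear convergence of specific architectures).** In each of the three cases, for almost every $(\theta_0,X_1,\dots,X_n)$ the following holds for every $T>0$. A gradient flow of $\mathcal L$ on $[0,T]$ started at $\theta_0$ exists, and for every such gradient flow $\theta$ there is $\lambda_0>0$ (which may depend on $T$ and on $\theta$) such that for all $t\in[0,T]$ $$\|y-F_t\|\le e^{-\lambda_0t}\|y-F_0\|,\qquad\text{equivalently}\qquad \mathcal L(\theta(t))\le e^{-2\lambda_0t}\mathcal L(\theta(0)),$$ where $F_t$ is the vector of all components of $f(X_1,\theta(t)),\dots,f(X_n,\theta(t))$ and $y$ is the vector of all components of $y_1,\dots,y_n$. -/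

import Mathlib

open MeasureTheory Filter Topology Set

namespace NNFlow

noncomputable section

/-! ### Activation functions -/

/-- A continuous function that is piecewise polynomial, with finitely many closed pieces, and
vanishes at finitely many points only. -/
def IsPiecewiseNonzeroPolynomial (σ : ℝ → ℝ) : Prop :=
  Continuous σ ∧
  (∃ (k : ℕ) (C : Fin k → Set ℝ) (p : Fin k → Polynomial ℝ),
    (∀ i, IsClosed (C i)) ∧ (⋃ i, C i) = univ ∧ ∀ i, ∀ x ∈ C i, σ x = (p i).eval x) ∧
  {x | σ x = 0}.Finite

def relu (x : ℝ) : ℝ := max x 0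

/-! ### Networks

A layer state with index set `ι` is a function `ι → ℝ`. -/

/-- The composition `g_L (σ (⋯ g_2 (σ (g_1 x)) ⋯))`, where `σ` acts componentwise on the output of
every layer but the last one, and not on the input `x`.  Layers are numbered from `0`. -/
def composeLayers {L : ℕ} {ι : Fin (L + 1) → Type} (σ : ℝ → ℝ)
    (g : ∀ i : Fin L, (ι i.castSucc → ℝ) → ι i.succ → ℝ) (x : ι 0 → ℝ) : ι (Fin.last L) → ℝ :=
  Fin.induction (motive := fun k => ι k → ℝ) x
    (fun i h => g i (if (i : ℕ) = 0 then h else fun a => σ (h a))) (Fin.last L)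

/-- Index set of the vector of all weights and biases of a fully connected network with layer
widths `N 0, …, N L`: for each layer, the entries of `W` and the entries of `B`. -/
abbrev DNNIndex {L : ℕ} (N : Fin (L + 1) → ℕ) : Type :=
  Σ i : Fin L, (Fin (N i.succ) × Fin (N i.castSucc)) ⊕ Fin (N i.succ)

theorem card_DNNIndex {L : ℕ} (N : Fin (L + 1) → ℕ) :
    Fintype.card (DNNIndex N) = ∑ i : Fin L, N i.succ * (N i.castSucc + 1) := by
  simp [DNNIndex, mul_add]

/-- Fully connected network, with layers `X ↦ W X + B`. -/
def dnn {L : ℕ} (N : Fin (L + 1) → ℕ) (σ : ℝ → ℝ) (x : Fin (N 0) → ℝ)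
    (θ : EuclideanSpace ℝ (DNNIndex N)) : Fin (N (Fin.last L)) → ℝ :=
  composeLayers (ι := fun k => Fin (N k)) σ
    (fun i h a => ∑ b, θ ⟨i, Sum.inl (a, b)⟩ * h b + θ ⟨i, Sum.inr a⟩) x

/-- Index set of the vector of all weights and biases of a residual network with `L` layers of
width `N`. -/
abbrev ResNetIndex (L N : ℕ) : Type :=
  Fin L × ((Fin N × Fin N) ⊕ Fin N)

theorem card_ResNetIndex (L N : ℕ) :
    Fintype.card (ResNetIndex L N) = L * (N ^ 2 + N) := by
  simp [ResNetIndex, sq]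

/-- Residual network, with layers `X ↦ X + W X + B`. -/
def resNet (L N : ℕ) (σ : ℝ → ℝ) (x : Fin N → ℝ)
    (θ : EuclideanSpace ℝ (ResNetIndex L N)) : Fin N → ℝ :=
  composeLayers (L := L) (ι := fun _ => Fin N) σ
    (fun i h a => h a + ∑ b, θ (i, Sum.inl (a, b)) * h b + θ (i, Sum.inr a)) x

/-- The matrix `D̂ ^ s * Â * D̂ ^ s`, with `Â = A + 1` for the adjacency matrix `A` of the graph,
and `D̂` the diagonal matrix of the row sums of `Â` (all of which are at least `1`). -/
def propagation {m : ℕ} (G : SimpleGraph (Fin m)) [DecidableRel G.Adj] (s : ℝ) :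
    Matrix (Fin m) (Fin m) ℝ :=
  let A' : Matrix (Fin m) (Fin m) ℝ := G.adjMatrix ℝ + 1
  let D' : Matrix (Fin m) (Fin m) ℝ := Matrix.diagonal fun u => (∑ v, A' u v) ^ s
  D' * A' * D'

/-- Index set of the vector of all weights and biases of a graph convolutional network over a
graph with `m` vertices and feature dimensions `N 0, …, N L`: for each layer, the entries of the
matrix `W` and those of the matrix `B`. -/
abbrev GCNIndex (m : ℕ) {L : ℕ} (N : Fin (L + 1) → ℕ) : Type :=
  Σ i : Fin L, (Fin (N i.castSucc) × Fin (N i.succ)) ⊕ (Fin m × Fin (N i.succ))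

theorem card_GCNIndex (m : ℕ) {L : ℕ} (N : Fin (L + 1) → ℕ) :
    Fintype.card (GCNIndex m N) = ∑ i : Fin L, N i.succ * (N i.castSucc + m) := by
  simp only [GCNIndex, Fintype.card_sigma, Fintype.card_sum, Fintype.card_prod, Fintype.card_fin]
  exact Finset.sum_congr rfl fun i _ => by ring

/-- Graph convolutional network, with layers `X ↦ S X W + B`, where `S = D̂ ^ s * Â * D̂ ^ s`.
A matrix is a function of a pair (vertex, feature). -/
def gcn {m L : ℕ} (G : SimpleGraph (Fin m)) [DecidableRel G.Adj] (s : ℝ)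
    (N : Fin (L + 1) → ℕ) (σ : ℝ → ℝ) (x : Fin m × Fin (N 0) → ℝ)
    (θ : EuclideanSpace ℝ (GCNIndex m N)) : Fin m × Fin (N (Fin.last L)) → ℝ :=
  composeLayers (ι := fun k => Fin m × Fin (N k)) σ
    (fun i h va =>
      (propagation G s * Matrix.of (fun u b => h (u, b)) *
        Matrix.of (fun b a => θ ⟨i, Sum.inl (b, a)⟩)) va.1 va.2 + θ ⟨i, Sum.inr va⟩) x

/-! ### Training: predictions, loss and gradient flow

`I` is the index set of the parameters, `O` that of an output, `𝒳` the space of inputs. -/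

/-- The vector `F` of all components of the outputs on all `n` inputs. -/
def predictions {n : ℕ} {𝒳 I O : Type} (f : 𝒳 → EuclideanSpace ℝ I → O → ℝ)
    (X : Fin n → 𝒳) (θ : EuclideanSpace ℝ I) : EuclideanSpace ℝ (Fin n × O) :=
  WithLp.toLp 2 fun p => f (X p.1) θ p.2

/-- The vector of all components of all labels. -/
def labels {n : ℕ} {O : Type} (y : Fin n → O → ℝ) : EuclideanSpace ℝ (Fin n × O) :=
  WithLp.toLp 2 fun p => y p.1 p.2

/-- The squared error `(1/2) ∑ j, ‖f (X j, θ) - y j‖²`, with Euclidean norms. -/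
def loss {n : ℕ} {𝒳 I O : Type} [Fintype O] (f : 𝒳 → EuclideanSpace ℝ I → O → ℝ)
    (X : Fin n → 𝒳) (y : Fin n → O → ℝ) (θ : EuclideanSpace ℝ I) : ℝ :=
  1 / 2 * ∑ j, ‖(WithLp.toLp 2 (f (X j) θ) : EuclideanSpace ℝ O) - WithLp.toLp 2 (y j)‖ ^ 2

/-- Clarke's generalized gradient of a (locally Lipschitz) function `Φ` at `x`: all `ξ` such that
`⟪ξ, v⟫ ≤ limsup (Φ (z + s v) - Φ z) / s`, as `z → x` and `s ↓ 0`, for every direction `v`. -/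
def clarkeGradient {E : Type} [NormedAddCommGroup E] [InnerProductSpace ℝ E]
    (Φ : E → ℝ) (x : E) : Set E :=
  {ξ | ∀ v : E, ((inner ℝ ξ v : ℝ) : EReal) ≤
    limsup (fun p : E × ℝ => (((Φ (p.1 + p.2 • v) - Φ p.1) / p.2 : ℝ) : EReal))
      (𝓝 x ×ˢ 𝓝[>] (0 : ℝ))}

/-- At a point where `Φ` is differentiable, the generalized gradient contains the gradient. -/
theorem mem_clarkeGradient_of_hasFDerivAt {E : Type} [NormedAddCommGroup E]
    [InnerProductSpace ℝ E] {Φ : E → ℝ} {x g : E}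
    (h : HasFDerivAt Φ (innerSL ℝ g) x) : g ∈ clarkeGradient Φ x := by
  intro v
  have h1 : Tendsto (fun s : ℝ => (Φ (x + s • v) - Φ x) / s) (𝓝[>] 0) (𝓝 (inner ℝ g v)) := by
    have h2 := (h.hasLineDerivAt v).tendsto_slope_zero_right
    refine (by simpa using h2 : Tendsto _ _ (𝓝 (inner ℝ g v))).congr fun s => ?_
    rw [div_eq_inv_mul]
  have h3 : Tendsto (fun s : ℝ => (x, s)) (𝓝[>] 0) (𝓝 x ×ˢ 𝓝[>] (0 : ℝ)) :=
    tendsto_const_nhds.prodMk tendsto_id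
  rw [← ((continuous_coe_real_ereal.tendsto _).comp h1).limsup_eq]
  exact limsup_le_limsup_of_le (u := fun p : E × ℝ =>
    (((Φ (p.1 + p.2 • v) - Φ p.1) / p.2 : ℝ) : EReal)) h3

/-- Where `Φ` is strictly differentiable (for instance, continuously differentiable near the
point), the generalized gradient consists of the gradient alone. -/
theorem clarkeGradient_eq_of_hasStrictFDerivAt {E : Type} [NormedAddCommGroup E]
    [InnerProductSpace ℝ E] {Φ : E → ℝ} {x g : E}
    (h : HasStrictFDerivAt Φ (innerSL ℝ g) x) : clarkeGradient Φ x = {g} := by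
  refine Subset.antisymm (fun ξ hξ => ?_)
    (singleton_subset_iff.2 (mem_clarkeGradient_of_hasFDerivAt h.hasFDerivAt))
  have key : ∀ v : E, inner ℝ ξ v ≤ inner ℝ g v := by
    intro v
    have h1 : Tendsto (fun p : E × ℝ => (p.1 + p.2 • v, p.1)) (𝓝 x ×ˢ 𝓝[>] (0 : ℝ))
        (𝓝 (x, x)) := by
      have hc : Tendsto (fun p : E × ℝ => (p.1 + p.2 • v, p.1)) (𝓝 (x, (0 : ℝ))) (𝓝 (x, x)) := by
        have : Continuous fun p : E × ℝ => (p.1 + p.2 • v, p.1) := by fun_prop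
        simpa using this.tendsto (x, (0 : ℝ))
      refine hc.mono_left ?_
      rw [nhds_prod_eq]
      exact Filter.prod_mono le_rfl nhdsWithin_le_nhds
    have h2 := h.isLittleO.comp_tendsto h1
    have h4 : (fun p : E × ℝ => Φ (p.1 + p.2 • v) - Φ p.1 - p.2 * inner ℝ g v)
        =o[𝓝 x ×ˢ 𝓝[>] (0 : ℝ)] fun p : E × ℝ => p.2 := by
      refine (h2.congr_left fun p => ?_).trans_isBigO ?_
      · simp [real_inner_smul_right]
      · refine Asymptotics.IsBigO.of_bound ‖v‖ (Eventually.of_forall fun p => ?_)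
        simp [norm_smul, mul_comm]
    have hpos : ∀ᶠ p : E × ℝ in 𝓝 x ×ˢ 𝓝[>] (0 : ℝ), p.2 ≠ 0 := by
      have : ∀ᶠ s : ℝ in 𝓝[>] 0, s ≠ 0 := by
        filter_upwards [self_mem_nhdsWithin] with s hs using ne_of_gt hs
      exact tendsto_snd.eventually this
    have h5 : Tendsto (fun p : E × ℝ => (Φ (p.1 + p.2 • v) - Φ p.1) / p.2)
        (𝓝 x ×ˢ 𝓝[>] (0 : ℝ)) (𝓝 (inner ℝ g v)) := by
      have h6 := h4.tendsto_div_nhds_zero.add_const (inner ℝ g v)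
      rw [zero_add] at h6
      refine h6.congr' ?_
      filter_upwards [hpos] with p hp
      field_simp
      ring
    have h7 := hξ v
    have h9 := ((continuous_coe_real_ereal.tendsto _).comp h5).limsup_eq
    exact EReal.coe_le_coe_iff.1 (h7.trans h9.le)
  have h8 := key (ξ - g)
  rw [← sub_nonpos, ← inner_sub_left] at h8
  rw [real_inner_self_eq_norm_sq] at h8
  have h10 := pow_eq_zero_iff two_ne_zero |>.1 (le_antisymm h8 (sq_nonneg _))
  exact mem_singleton_iff.2 (sub_eq_zero.1 (norm_eq_zero.1 h10))

/-- `θ` is a gradient flow of `Φ` on `[0, T]` started at `θ₀`: it is absolutely continuous,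
`θ 0 = θ₀`, and `θ' = -∇Φ(θ)` at almost every time, where `∇Φ` stands for any element of the
generalized gradient at the points where `Φ` is not continuously differentiable. -/
def IsGradientFlow {E : Type} [NormedAddCommGroup E] [InnerProductSpace ℝ E]
    (Φ : E → ℝ) (T : ℝ) (θ₀ : E) (θ : ℝ → E) : Prop :=
  θ 0 = θ₀ ∧ AbsolutelyContinuousOnInterval θ 0 T ∧
  ∀ᵐ t ∂(volume.restrict (Icc 0 T)), ∃ v : E, HasDerivAt θ v t ∧ -v ∈ clarkeGradient Φ (θ t)

/-- Almost surely with respect to the joint law `μ` of the initialization `θ₀` and the inputs `X`,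
for every `T > 0`: a gradient flow of the loss on `[0, T]` started at `θ₀` exists, and along every
such gradient flow the error decays exponentially on `[0, T]`, at some rate `lam > 0`. -/
def ConvergesLinearly {n : ℕ} {𝒳 I O : Type} [MeasurableSpace 𝒳] [Fintype I] [Fintype O]
    (f : 𝒳 → EuclideanSpace ℝ I → O → ℝ) (y : Fin n → O → ℝ)
    (μ : Measure (EuclideanSpace ℝ I × (Fin n → 𝒳))) : Prop :=
  ∀ᵐ p ∂μ, ∀ T : ℝ, 0 < T →
    (∃ θ : ℝ → EuclideanSpace ℝ I, IsGradientFlow (loss f p.2 y) T p.1 θ) ∧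
    ∀ θ : ℝ → EuclideanSpace ℝ I, IsGradientFlow (loss f p.2 y) T p.1 θ →
      ∃ lam : ℝ, 0 < lam ∧ ∀ t ∈ Icc 0 T,
        ‖labels y - predictions f p.2 (θ t)‖ ≤
          Real.exp (-lam * t) * ‖labels y - predictions f p.2 (θ 0)‖ ∧
        loss f p.2 y (θ t) ≤ Real.exp (-2 * lam * t) * loss f p.2 y (θ 0)

end

end NNFlow

/-! The rate may depend on `T` and on the flow, so it is enough that the loss drops strictly near
time 0 and never increases afterwards: a function bounded by `Φ(0) - κ t` on `[0, T]` is bounded by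
`exp (-κ t / Φ(0)) Φ(0)`.

The strict drop comes from one parameter, a bias of the last layer. Shifting it translates one
output component on every input, so the loss is exactly quadratic in that direction, even where it
is not differentiable elsewhere. Every Clarke gradient therefore has the same component along it,
the sum `G` of the residuals of that output component (`inner_eq_of_mem_clarkeGradient`). `G` is
affine in the bias with slope `n`, so for `n > 0` it is nonzero for almost every initialization and
input; being continuous, it stays away from 0 for a short time.

Monotonicity requires a chain rule for a nonsmooth loss. All three kinds of activation are
continuous selections of finitely many `C¹` functions, a class (`IsPC1`) stable under the operations
that build a network and its loss. For such functions all active pieces have the same derivative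
along a curve at almost every time, which gives `d/dt Φ(θ) ≤ -‖ξ‖²` for some `ξ` in the Clarke
gradient (`IsGradientFlow.dissipation`).

Existence is obtained by minimizing movements: implicit Euler steps, each a penalized minimization,
with step size tending to 0 (`exists_isGradientFlow`). -/

namespace NNFlow

/-! ### Piecewise `C¹` functions and their closure properties -/

/-- A continuous selection of finitely many continuously differentiable functions. -/
def IsPC1 {E : Type*} [NormedAddCommGroup E] [NormedSpace ℝ E] (f : E → ℝ) : Prop :=
  Continuous f ∧ ∃ S : Set (E → ℝ), S.Finite ∧ (∀ p ∈ S, ContDiff ℝ 1 p) ∧ ∀ x, ∃ p ∈ S, f x = p x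

namespace IsPC1

variable {E F : Type*} [NormedAddCommGroup E] [NormedSpace ℝ E]
  [NormedAddCommGroup F] [NormedSpace ℝ F] {f g : E → ℝ}

theorem of_contDiff (hf : ContDiff ℝ 1 f) : IsPC1 f :=
  ⟨hf.continuous, {f}, finite_singleton f, by simpa using hf, fun _ => ⟨f, rfl, rfl⟩⟩

theorem const (c : ℝ) : IsPC1 fun _ : E => c := of_contDiff contDiff_const

theorem add (hf : IsPC1 f) (hg : IsPC1 g) : IsPC1 fun x => f x + g x := by
  obtain ⟨cf, S, hS, hSd, hSf⟩ := hf
  obtain ⟨cg, S', hS', hSd', hSg⟩ := hg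
  refine ⟨cf.add cg, image2 (fun p q x => p x + q x) S S', hS.image2 _ hS', ?_, fun x => ?_⟩
  · rintro _ ⟨p, hp, q, hq, rfl⟩
    exact (hSd p hp).add (hSd' q hq)
  · obtain ⟨p, hp, h1⟩ := hSf x
    obtain ⟨q, hq, h2⟩ := hSg x
    exact ⟨_, mem_image2_of_mem hp hq, by simp only [h1, h2]⟩

theorem mul (hf : IsPC1 f) (hg : IsPC1 g) : IsPC1 fun x => f x * g x := by
  obtain ⟨cf, S, hS, hSd, hSf⟩ := hf
  obtain ⟨cg, S', hS', hSd', hSg⟩ := hg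
  refine ⟨cf.mul cg, image2 (fun p q x => p x * q x) S S', hS.image2 _ hS', ?_, fun x => ?_⟩
  · rintro _ ⟨p, hp, q, hq, rfl⟩
    exact (hSd p hp).mul (hSd' q hq)
  · obtain ⟨p, hp, h1⟩ := hSf x
    obtain ⟨q, hq, h2⟩ := hSg x
    exact ⟨_, mem_image2_of_mem hp hq, by simp only [h1, h2]⟩

theorem comp {φ : ℝ → ℝ} (hφ : IsPC1 φ) (hf : IsPC1 f) : IsPC1 fun x => φ (f x) := by
  obtain ⟨cf, S, hS, hSd, hSf⟩ := hφ
  obtain ⟨cg, S', hS', hSd', hSg⟩ := hf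
  refine ⟨cf.comp cg, image2 (fun p q x => p (q x)) S S', hS.image2 _ hS', ?_, fun x => ?_⟩
  · rintro _ ⟨p, hp, q, hq, rfl⟩
    exact (hSd p hp).comp (hSd' q hq)
  · obtain ⟨q, hq, h2⟩ := hSg x
    obtain ⟨p, hp, h1⟩ := hSf (q x)
    exact ⟨_, mem_image2_of_mem hp hq, by simp only [h2, h1]⟩

theorem comp_contDiff (hf : IsPC1 f) {u : F → E} (hu : ContDiff ℝ 1 u) :
    IsPC1 fun x => f (u x) := by
  obtain ⟨cf, S, hS, hSd, hSf⟩ := hf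
  refine ⟨cf.comp hu.continuous, (fun p x => p (u x)) '' S, hS.image _, ?_, fun x => ?_⟩
  · rintro _ ⟨p, hp, rfl⟩
    exact (hSd p hp).comp hu
  · obtain ⟨p, hp, h⟩ := hSf (u x)
    exact ⟨_, mem_image_of_mem _ hp, h⟩

theorem sum {ι : Type*} (s : Finset ι) {f : ι → E → ℝ} (hf : ∀ i ∈ s, IsPC1 (f i)) :
    IsPC1 fun x => ∑ i ∈ s, f i x := by
  classical
  induction s using Finset.induction_on with
  | empty => simpa using const 0
  | insert a s ha ih =>
    simp only [Finset.sum_insert ha]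
    exact (hf a (Finset.mem_insert_self a s)).add
      (ih fun i hi => hf i (Finset.mem_insert_of_mem hi))

end IsPC1

/-! ### Mean value and Lipschitz estimates for selections -/

section Selection

variable {E : Type*} [NormedAddCommGroup E] [NormedSpace ℝ E]

/-- Mean value inequality for a continuous selection of differentiable functions. -/
theorem selection_sub_le {f : E → ℝ} (hf : Continuous f) {S : Set (E → ℝ)} (hS : S.Finite)
    (hSd : ∀ p ∈ S, ContDiff ℝ 1 p) {U : Set E} (hU : Convex ℝ U)
    (hfS : ∀ z ∈ U, ∃ p ∈ S, f z = p z) {v : E} {c : ℝ}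
    (hc : ∀ p ∈ S, ∀ z ∈ U, fderiv ℝ p z v ≤ c) {z : E} {s : ℝ} (hs : 0 ≤ s) (hz : z ∈ U)
    (hzs : z + s • v ∈ U) : f (z + s • v) - f z ≤ c * s := by
  have hseg : ∀ τ ∈ Icc 0 s, z + τ • v ∈ U := by
    intro τ hτ
    rcases hs.eq_or_lt with h0 | h0
    · have : τ = 0 := le_antisymm (h0 ▸ hτ.2) hτ.1
      simpa [this] using hz
    · have := hU.add_smul_mem hz hzs (t := τ / s)
        ⟨div_nonneg hτ.1 hs, div_le_one_of_le₀ hτ.2 hs⟩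
      rwa [smul_smul, div_mul_cancel₀ _ h0.ne'] at this
  have hline : Continuous fun τ : ℝ => z + τ • v := by fun_prop
  have key := image_le_of_liminf_slope_right_le_deriv_boundary
    (f := fun τ => f (z + τ • v)) (a := 0) (b := s) (hf.comp hline).continuousOn
    (B := fun τ => f z + c * τ) (B' := fun _ => c) (by simp) (by fun_prop)
    (fun x _ => by
      simpa using (((hasDerivAt_id x).const_mul c).const_add (f z)).hasDerivWithinAt) ?_
  · have := key (right_mem_Icc.2 hs)
    linarith
  intro x hx r hr
  have hev : ∀ᶠ y in 𝓝[>] x, ∃ p ∈ S, f (z + y • v) = p (z + y • v) := by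
    filter_upwards [Ioo_mem_nhdsGT hx.2] with y hy
    exact hfS _ (hseg y ⟨hx.1.trans hy.1.le, hy.2.le⟩)
  -- Pigeonhole on the finite set `S`: a single `p` agrees with `f` at points arbitrarily close to
  -- `x` from the right. The comparison theorem only asks for small slopes frequently, so the slopes
  -- of this `p` suffice.
  obtain ⟨p, hp, hfr⟩ : ∃ p ∈ S, ∃ᶠ y in 𝓝[>] x, f (z + y • v) = p (z + y • v) := by
    by_contra! hcon
    have h1 : ∀ᶠ y in 𝓝[>] x, ∀ p ∈ S, f (z + y • v) ≠ p (z + y • v) :=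
      (hS.eventually_all).2 fun p hp => by simpa using hcon p hp
    obtain ⟨y, ⟨p, hp, hy⟩, hy'⟩ := (hev.and h1).exists
    exact hy' p hp hy
  have heq : f (z + x • v) = p (z + x • v) := by
    have hcl : IsClosed {y : ℝ | f (z + y • v) = p (z + y • v)} :=
      isClosed_eq (hf.comp hline) ((hSd p hp).continuous.comp hline)
    exact hcl.closure_subset (mem_closure_iff_frequently.2 (hfr.filter_mono nhdsWithin_le_nhds))
  have hd : HasDerivAt (fun τ : ℝ => p (z + τ • v)) (fderiv ℝ p (z + x • v) v) x := by
    have h1 : HasDerivAt (fun τ : ℝ => z + τ • v) v x := by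
      simpa using ((hasDerivAt_id x).smul_const v).const_add z
    exact (((hSd p hp).differentiable one_ne_zero _).hasFDerivAt).comp_hasDerivAt x h1
  have hlt : ∀ᶠ y in 𝓝[>] x, slope (fun τ : ℝ => p (z + τ • v)) x y < r := by
    have h1 := (hasDerivAt_iff_tendsto_slope.1 hd).mono_left
      (nhdsWithin_mono x (fun y (hy : x < y) => hy.ne'))
    exact h1.eventually (Iio_mem_nhds ((hc p hp _ (hseg x ⟨hx.1, hx.2.le⟩)).trans_lt hr))
  refine (hfr.and_eventually hlt).mono fun y hy => ?_
  simpa only [slope_def_field, hy.1, heq] using hy.2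

/-- On a compact ball the derivatives of the finitely many pieces have a common bound, and balls are
convex, so the mean value inequality applies. -/
theorem IsPC1.exists_lipschitzOnWith [FiniteDimensional ℝ E] {f : E → ℝ} (hf : IsPC1 f)
    (x : E) (R : ℝ) : ∃ K : NNReal, LipschitzOnWith K f (Metric.closedBall x R) := by
  have : ProperSpace E := FiniteDimensional.proper_real E
  obtain ⟨cf, S, hS, hSd, hfS⟩ := hf
  have h1 : ∀ p ∈ S, ∃ C : ℝ, ∀ z ∈ Metric.closedBall x R, ‖fderiv ℝ p z‖ ≤ C := fun p hp =>
    (isCompact_closedBall x R).exists_bound_of_continuousOn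
      ((hSd p hp).continuous_fderiv one_ne_zero).continuousOn
  obtain ⟨C, hC⟩ : ∃ C : ℝ, ∀ p ∈ S, ∀ z ∈ Metric.closedBall x R, ‖fderiv ℝ p z‖ ≤ C := by
    choose! C hC using h1
    obtain ⟨M, hM⟩ := (hS.image C).bddAbove
    exact ⟨M, fun p hp z hz => (hC p hp z hz).trans (hM (mem_image_of_mem C hp))⟩
  refine ⟨C.toNNReal, LipschitzOnWith.of_le_add_mul _ fun y hy z hz => ?_⟩
  have h2 := selection_sub_le cf hS hSd (convex_closedBall x R) (fun z _ => hfS z)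
    (v := y - z) (c := C.toNNReal * dist y z) (fun p hp w hw => ?_) zero_le_one hz
    (by simpa using hy)
  · simp only [one_smul, add_sub_cancel, mul_one] at h2
    linarith
  · rw [dist_eq_norm]
    refine (le_abs_self _).trans (((fderiv ℝ p w).le_opNorm _).trans ?_)
    gcongr
    exact (hC p hp w hw).trans (Real.le_coe_toNNReal C)

end Selection

/-! ### Upper bounds for Clarke gradients -/

section Clarke

variable {E : Type} [NormedAddCommGroup E] [InnerProductSpace ℝ E]

theorem inner_le_of_mem_clarkeGradient {Φ : E → ℝ} {x ξ v : E} {c : ℝ}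
    (hξ : ξ ∈ clarkeGradient Φ x)
    (h : ∀ ε > 0, ∀ᶠ p : E × ℝ in 𝓝 x ×ˢ 𝓝[>] (0 : ℝ),
      (Φ (p.1 + p.2 • v) - Φ p.1) / p.2 ≤ c + ε) :
    inner ℝ ξ v ≤ c := by
  refine le_of_forall_pos_le_add fun ε hε => ?_
  have h1 := (hξ v).trans (limsup_le_of_le (a := ((c + ε : ℝ) : EReal)) (by isBoundedDefault)
    ((h ε hε).mono fun p hp => EReal.coe_le_coe_iff.2 hp))
  exact EReal.coe_le_coe_iff.1 h1

theorem tendsto_add_smul_nhds (x v : E) :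
    Tendsto (fun p : E × ℝ => p.1 + p.2 • v) (𝓝 x ×ˢ 𝓝[>] (0 : ℝ)) (𝓝 x) := by
  have hc : Tendsto (fun p : E × ℝ => p.1 + p.2 • v) (𝓝 (x, (0 : ℝ))) (𝓝 x) := by
    have : Continuous fun p : E × ℝ => p.1 + p.2 • v := by fun_prop
    simpa using this.tendsto (x, (0 : ℝ))
  refine hc.mono_left ?_
  rw [nhds_prod_eq]
  exact Filter.prod_mono le_rfl nhdsWithin_le_nhds

theorem eventually_snd_pos {E : Type*} [TopologicalSpace E] (x : E) :
    ∀ᶠ p : E × ℝ in 𝓝 x ×ˢ 𝓝[>] (0 : ℝ), 0 < p.2 :=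
  tendsto_snd.eventually self_mem_nhdsWithin

/-- The generalized gradient of a selection is controlled by the active functions. -/
theorem inner_le_of_mem_clarkeGradient_selection {f : E → ℝ} (hf : Continuous f)
    {S : Set (E → ℝ)} (hS : S.Finite) (hSd : ∀ p ∈ S, ContDiff ℝ 1 p)
    (hfS : ∀ z, ∃ p ∈ S, f z = p z) {x ξ v : E} {c : ℝ} (hξ : ξ ∈ clarkeGradient f x)
    (hc : ∀ p ∈ S, f x = p x → fderiv ℝ p x v ≤ c) : inner ℝ ξ v ≤ c := by
  refine inner_le_of_mem_clarkeGradient hξ fun ε hε => ?_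
  -- Pieces inactive at `x` remain inactive nearby, so on a small ball `f` is a selection of the
  -- pieces active at `x` alone.
  have h1 : ∀ᶠ z in 𝓝 x, ∀ p ∈ S, (f x ≠ p x → f z ≠ p z) ∧
      (f x = p x → fderiv ℝ p z v < c + ε) := by
    refine (hS.eventually_all).2 fun p hp => Eventually.and ?_ ?_
    · by_cases h : f x = p x
      · simp [h]
      · filter_upwards [(isOpen_ne_fun hf (hSd p hp).continuous).mem_nhds h] with z hz _ using hz
    · by_cases h : f x = p x
      · have h2 : Continuous fun z => fderiv ℝ p z v :=
          ((hSd p hp).continuous_fderiv one_ne_zero).clm_apply continuous_const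
        filter_upwards [h2.continuousAt.eventually (Iio_mem_nhds (show fderiv ℝ p x v < c + ε by
          linarith [hc p hp h]))] with z hz _ using hz
      · simp [h]
  obtain ⟨r, hr, hball⟩ := Metric.eventually_nhds_iff_ball.1 h1
  filter_upwards [(tendsto_add_smul_nhds x v).eventually (Metric.ball_mem_nhds x hr),
    tendsto_fst.eventually (Metric.ball_mem_nhds x hr), eventually_snd_pos x] with q hq1 hq2 hq3
  rw [div_le_iff₀ hq3]
  refine selection_sub_le hf (S := {p ∈ S | f x = p x}) (hS.subset (sep_subset _ _))
    (fun p hp => hSd p hp.1) (convex_ball x r) (fun z hz => ?_)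
    (fun p hp z hz => ((hball z hz p hp.1).2 hp.2).le) hq3.le hq2 hq1
  obtain ⟨p, hp, h⟩ := hfS z
  exact ⟨p, ⟨hp, by_contra fun h' => (hball z hz p hp).1 h' h⟩, h⟩

/-- Along a direction in which a function is quadratic, all generalized gradients agree. -/
theorem inner_eq_of_mem_clarkeGradient {Φ G : E → ℝ} (hG : Continuous G) {w : E} {q : ℝ}
    (h : ∀ z s, Φ (z + s • w) = Φ z + s * G z + s ^ 2 * q) {x ξ : E}
    (hξ : ξ ∈ clarkeGradient Φ x) : inner ℝ ξ w = G x := by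
  have key : ∀ (w : E) (G : E → ℝ), Continuous G →
      (∀ z s, Φ (z + s • w) = Φ z + s * G z + s ^ 2 * q) → inner ℝ ξ w ≤ G x := by
    intro w G hG h
    refine inner_le_of_mem_clarkeGradient hξ fun ε hε => ?_
    have h1 : Tendsto (fun p : E × ℝ => G p.1 + p.2 * q) (𝓝 x ×ˢ 𝓝[>] (0 : ℝ)) (𝓝 (G x)) := by
      have h2 : Tendsto (fun p : E × ℝ => p.2) (𝓝 x ×ˢ 𝓝[>] (0 : ℝ)) (𝓝 0) :=
        tendsto_snd.mono_right nhdsWithin_le_nhds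
      simpa using ((hG.tendsto x).comp tendsto_fst).add (h2.mul_const q)
    filter_upwards [h1.eventually (Iio_mem_nhds (show G x < G x + ε by linarith)),
      eventually_snd_pos x] with p hp hp'
    rw [h, div_le_iff₀ hp']
    have hp'' : G p.1 + p.2 * q < G x + ε := hp
    nlinarith
  refine le_antisymm (key w G hG h) ?_
  -- Reversing the direction changes the sign of the slope and keeps `q`; it supplies the opposite
  -- inequality.
  have h2 := key (-w) (fun z => -G z) hG.neg fun z s => by
    have := h z (-s)
    simp only [neg_smul, ← smul_neg] at this
    rw [this]
    ring
  rw [inner_neg_right] at h2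
  linarith

end Clarke

/-! ### Chain rule along curves and energy dissipation -/

section ChainRule

variable {E : Type} [NormedAddCommGroup E] [InnerProductSpace ℝ E]

/-- Almost everywhere along a curve, all active functions of a selection have the same derivative
along the curve. -/
theorem ae_fderiv_eq_of_selection {f : E → ℝ} {S : Set (E → ℝ)} (hS : S.Finite)
    (hSd : ∀ p ∈ S, ContDiff ℝ 1 p) (θ : ℝ → E) :
    ∀ᵐ t : ℝ, ∀ p ∈ S, f (θ t) = p (θ t) → ∀ d v, HasDerivAt (fun τ => f (θ τ)) d t →
      HasDerivAt θ v t → fderiv ℝ p (θ t) v = d := by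
  refine (ae_ball_iff hS.countable).2 fun p hp => ?_
  -- The times of coincidence with `p` that are isolated from the right are countable, hence null.
  -- At any other, the difference has slope 0 along times decreasing to `t`, so its derivative
  -- vanishes.
  have hcount := countable_setOfPred_isolated_right_within (s := {t | f (θ t) = p (θ t)})
  filter_upwards [hcount.ae_notMem volume] with t ht htp d v hd hv
  have hfr : ∃ᶠ τ in 𝓝[>] t, f (θ τ) = p (θ τ) := by
    have h1 : 𝓝[{t | f (θ t) = p (θ t)} ∩ Ioi t] t ≠ ⊥ := fun h => ht ⟨htp, h⟩
    rw [Filter.frequently_iff_neBot, ← nhdsWithin_inter', inter_comm]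
    exact ⟨h1⟩
  have hp' : HasDerivAt (fun τ => p (θ τ)) (fderiv ℝ p (θ t) v) t :=
    (((hSd p hp).differentiable one_ne_zero _).hasFDerivAt).comp_hasDerivAt t hv
  have hsl := (hasDerivAt_iff_tendsto_slope.1 (hp'.sub hd)).mono_left
    (nhdsWithin_mono t (fun y (hy : t < y) => hy.ne'))
  have h0 : ∃ᶠ τ in 𝓝[>] t, slope ((fun τ => p (θ τ)) - fun τ => f (θ τ)) t τ ∈ ({0} : Set ℝ) :=
    hfr.mono fun τ hτ => by
      simp [slope_def_field, hτ, htp]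
  have := isClosed_singleton.mem_of_frequently_of_tendsto h0 hsl
  exact sub_eq_zero.1 this

theorem _root_.LipschitzOnWith.comp_absolutelyContinuousOnInterval {X Y : Type*}
    [PseudoMetricSpace X] [PseudoMetricSpace Y] {K : NNReal} {f : X → Y} {s : Set X}
    (hf : LipschitzOnWith K f s) {θ : ℝ → X} {a b : ℝ}
    (hθ : AbsolutelyContinuousOnInterval θ a b) (hs : MapsTo θ (uIcc a b) s) :
    AbsolutelyContinuousOnInterval (fun t => f (θ t)) a b := by
  rw [absolutelyContinuousOnInterval_iff] at hθ ⊢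
  intro ε hε
  obtain ⟨δ, hδ, h⟩ := hθ (ε / (K + 1)) (by positivity)
  refine ⟨δ, hδ, fun I hI hlen => ?_⟩
  calc ∑ i ∈ Finset.range I.1, dist (f (θ (I.2 i).1)) (f (θ (I.2 i).2))
      ≤ ∑ i ∈ Finset.range I.1, (K + 1) * dist (θ (I.2 i).1) (θ (I.2 i).2) := by
        refine Finset.sum_le_sum fun i hi => ?_
        refine (hf.dist_le_mul _ (hs (hI.1 i hi).1) _ (hs (hI.1 i hi).2)).trans ?_
        gcongr
        simp
    _ = (K + 1) * ∑ i ∈ Finset.range I.1, dist (θ (I.2 i).1) (θ (I.2 i).2) :=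
        (Finset.mul_sum _ _ _).symm
    _ < (K + 1) * (ε / (K + 1)) := by
        gcongr
        exact h I hI hlen
    _ = ε := by field_simp

theorem _root_.AbsolutelyContinuousOnInterval.le_sub_of_deriv_le {g : ℝ → ℝ} {a b κ : ℝ}
    (hab : a ≤ b) (hg : AbsolutelyContinuousOnInterval g a b)
    (h : ∀ᵐ t ∂(volume.restrict (Icc a b)), deriv g t ≤ -κ) : g b ≤ g a - κ * (b - a) := by
  have h1 := intervalIntegral.integral_mono_ae_restrict hab hg.intervalIntegrable_deriv
    (intervalIntegrable_const (c := -κ)) h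
  rw [hg.integral_deriv_eq_sub, intervalIntegral.integral_const, smul_eq_mul] at h1
  linarith

/-- Energy dissipation along a gradient flow of a piecewise `C¹` function. -/
theorem IsGradientFlow.dissipation [FiniteDimensional ℝ E] {Φ : E → ℝ} (hΦ : IsPC1 Φ) {T : ℝ}
    (hT : 0 ≤ T) {θ₀ : E} {θ : ℝ → E} (h : IsGradientFlow Φ T θ₀ θ) :
    AbsolutelyContinuousOnInterval (fun t => Φ (θ t)) 0 T ∧
    ∀ᵐ t ∂(volume.restrict (Icc 0 T)), ∃ ξ ∈ clarkeGradient Φ (θ t),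
      deriv (fun t => Φ (θ t)) t ≤ -‖ξ‖ ^ 2 := by
  obtain ⟨-, hac, hflow⟩ := h
  obtain ⟨C, hC⟩ := hac.exists_bound
  obtain ⟨K, hK⟩ := hΦ.exists_lipschitzOnWith 0 C
  have hac' : AbsolutelyContinuousOnInterval (fun t => Φ (θ t)) 0 T :=
    hK.comp_absolutelyContinuousOnInterval hac fun t ht => by simpa using hC t ht
  refine ⟨hac', ?_⟩
  obtain ⟨cf, S, hS, hSd, hfS⟩ := hΦ
  have hd := hac'.ae_differentiableAt
  rw [uIcc_of_le hT] at hd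
  rw [ae_restrict_iff' measurableSet_Icc] at hflow ⊢
  filter_upwards [hflow, hd, ae_fderiv_eq_of_selection (f := Φ) hS hSd θ] with t h1 h2 h3 ht
  obtain ⟨v, hv, hvc⟩ := h1 ht
  refine ⟨-v, hvc, ?_⟩
  -- The element `-v` is tested against the direction `-v` itself, in which every active piece has
  -- derivative `-d/dt Φ(θ)`.
  have h4 := inner_le_of_mem_clarkeGradient_selection cf hS hSd hfS hvc (v := -v)
    (c := -deriv (fun t => Φ (θ t)) t) fun p hp hpt => by
      rw [map_neg, h3 p hp hpt _ _ (h2 ht).hasDerivAt hv]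
  rw [real_inner_self_eq_norm_sq] at h4
  linarith

end ChainRule

/-! ### Implicit Euler steps: a priori bounds -/

section ProxStep

variable {E : Type*} [NormedAddCommGroup E]

/-- `y` minimizes `Φ` with a quadratic penalty on the distance to `x`. -/
def IsProxStep (Φ : E → ℝ) (h : ℝ) (x y : E) : Prop :=
  ∀ z, Φ y + ‖y - x‖ ^ 2 / (2 * h) ≤ Φ z + ‖z - x‖ ^ 2 / (2 * h)

theorem IsProxStep.sq_norm_sub_le {Φ : E → ℝ} {h : ℝ} (hh : 0 < h) {x y : E}
    (hy : IsProxStep Φ h x y) : ‖y - x‖ ^ 2 ≤ 2 * h * (Φ x - Φ y) := by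
  have h1 := hy x
  simp only [sub_self, norm_zero, ne_eq, OfNat.ofNat_ne_zero, not_false_eq_true, zero_pow,
    zero_div, add_zero] at h1
  have h2 : ‖y - x‖ ^ 2 / (2 * h) ≤ Φ x - Φ y := by linarith
  rw [div_le_iff₀ (by positivity)] at h2
  linarith

/-- The inequality `2ab ≤ a² + b²` turns the quadratic bound into one whose energy part telescopes.
It confines the iterates to a ball before any Lipschitz constant is chosen; that constant then
bounds their speed. -/
theorem IsProxStep.norm_sub_le {Φ : E → ℝ} {h : ℝ} (hh : 0 < h) {x y : E}
    (hy : IsProxStep Φ h x y) : ‖y - x‖ ≤ Φ x - Φ y + h / 2 := by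
  have h1 := hy.sq_norm_sub_le hh
  have h2 : 2 * ‖y - x‖ * h ≤ ‖y - x‖ ^ 2 + h ^ 2 := two_mul_le_add_sq _ _
  nlinarith

theorem IsProxStep.norm_sub_le_of_lipschitzOnWith {Φ : E → ℝ} {h : ℝ} (hh : 0 < h) {x y : E}
    (hy : IsProxStep Φ h x y) {K : NNReal} {s : Set E} (hK : LipschitzOnWith K Φ s)
    (hxs : x ∈ s) (hys : y ∈ s) : ‖y - x‖ ≤ 2 * K * h := by
  have h1 := hy.sq_norm_sub_le hh
  have h2 := hK.dist_le_mul x hxs y hys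
  rw [Real.dist_eq, dist_comm, dist_eq_norm] at h2
  have h3 := (le_abs_self _).trans h2
  rcases (norm_nonneg (y - x)).eq_or_lt with h4 | h4
  · rw [← h4]
    positivity
  · have h5 : ‖y - x‖ * ‖y - x‖ ≤ ‖y - x‖ * (2 * K * h) := by
      nlinarith [mul_le_mul_of_nonneg_left h3 hh.le]
    exact le_of_mul_le_mul_left h5 h4

variable {Φ : E → ℝ} {h : ℝ} {x : ℕ → E}

theorem norm_sub_zero_le_of_isProxStep (hh : 0 < h) (hx : ∀ i, IsProxStep Φ h (x i) (x (i + 1)))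
    (i : ℕ) : ‖x i - x 0‖ ≤ Φ (x 0) - Φ (x i) + i * h := by
  induction i with
  | zero => simp
  | succ i ih =>
    have h1 := (hx i).norm_sub_le hh
    have h2 := norm_sub_le_norm_sub_add_norm_sub (x (i + 1)) (x i) (x 0)
    push_cast
    linarith

theorem norm_sub_le_of_isProxStep (hh : 0 < h) (hx : ∀ i, IsProxStep Φ h (x i) (x (i + 1)))
    {K : NNReal} {s : Set E} (hK : LipschitzOnWith K Φ s) {i j : ℕ} (hij : i ≤ j)
    (hs : ∀ k ≤ j, x k ∈ s) : ‖x j - x i‖ ≤ 2 * K * (j * h - i * h) := by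
  induction j, hij using Nat.le_induction with
  | base => simp
  | succ j hij ih =>
    have h1 := (hx j).norm_sub_le_of_lipschitzOnWith hh hK (hs j (by omega)) (hs (j + 1) le_rfl)
    have h2 := norm_sub_le_norm_sub_add_norm_sub (x (j + 1)) (x j) (x i)
    have h3 := ih fun k hk => hs k (by omega)
    push_cast
    linarith

end ProxStep

/-! ### Existence of gradient flows by minimizing movements -/

section Existence

variable {E : Type} [NormedAddCommGroup E] [InnerProductSpace ℝ E]

theorem exists_isProxStep [FiniteDimensional ℝ E] {Φ : E → ℝ} (hΦ : Continuous Φ)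
    (h0 : ∀ x, 0 ≤ Φ x) {h : ℝ} (hh : 0 < h) (x : E) : ∃ y, IsProxStep Φ h x y := by
  have : ProperSpace E := FiniteDimensional.proper_real E
  refine Continuous.exists_forall_le (f := fun z => Φ z + ‖z - x‖ ^ 2 / (2 * h)) (by fun_prop) ?_
  have h1 : Tendsto (fun z => dist z x) (cocompact E) atTop := tendsto_dist_right_cocompact_atTop x
  have h2 : Tendsto (fun z => dist z x ^ 2 / (2 * h)) (cocompact E) atTop :=
    ((tendsto_pow_atTop two_ne_zero).comp h1).atTop_div_const (by positivity)
  refine tendsto_atTop_mono (fun z => ?_) h2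
  rw [dist_eq_norm]
  linarith [h0 z]

/-- First-order optimality of `y` in the direction `v`; the penalty contributes the inner product
and an error that vanishes with `s`. -/
theorem IsProxStep.inner_le {Φ : E → ℝ} {h : ℝ} (hh : 0 < h) {x y v : E} {D : ℝ}
    (hy : IsProxStep Φ h x y) (hD : ∀ᶠ s in 𝓝[>] (0 : ℝ), (Φ (y + s • v) - Φ y) / s < D) :
    inner ℝ (x - y) v ≤ h * D := by
  have h1 : Tendsto (fun s : ℝ => h * D + s * (‖v‖ ^ 2 / 2)) (𝓝[>] 0) (𝓝 (h * D)) := by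
    have : Continuous fun s : ℝ => h * D + s * (‖v‖ ^ 2 / 2) := by fun_prop
    simpa using (this.tendsto 0).mono_left nhdsWithin_le_nhds
  refine ge_of_tendsto h1 ?_
  filter_upwards [hD, self_mem_nhdsWithin] with s hs (hs0 : 0 < s)
  rw [div_lt_iff₀ hs0] at hs
  have h2 := hy (y + s • v)
  have h3 : ‖y + s • v - x‖ ^ 2 = ‖y - x‖ ^ 2 - 2 * (s * inner ℝ (x - y) v) + s ^ 2 * ‖v‖ ^ 2 := by
    have : y + s • v - x = (y - x) + s • v := by abel
    rw [this, norm_add_sq_real, inner_smul_right, norm_smul, mul_pow, Real.norm_eq_abs, sq_abs,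
      ← neg_sub x y, inner_neg_left, norm_neg]
    ring
  rw [h3] at h2
  have h4 : (s * inner ℝ (x - y) v) / h ≤ s * D + s ^ 2 * ‖v‖ ^ 2 / (2 * h) := by
    have : (‖y - x‖ ^ 2 - 2 * (s * inner ℝ (x - y) v) + s ^ 2 * ‖v‖ ^ 2) / (2 * h) =
      ‖y - x‖ ^ 2 / (2 * h) - (s * inner ℝ (x - y) v) / h + s ^ 2 * ‖v‖ ^ 2 / (2 * h) := by
      field_simp
    rw [this] at h2
    linarith
  rw [div_le_iff₀ hh] at h4
  have h5 : (s * D + s ^ 2 * ‖v‖ ^ 2 / (2 * h)) * h = s * (h * D + s * (‖v‖ ^ 2 / 2)) := by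
    field_simp
  rw [h5] at h4
  exact le_of_mul_le_mul_left h4 hs0

theorem inner_le_of_isProxStep {Φ : E → ℝ} {h : ℝ} {x : ℕ → E} (hh : 0 < h)
    (hx : ∀ i, IsProxStep Φ h (x i) (x (i + 1))) {v : E} {D : ℝ} {i j : ℕ} (hij : i ≤ j)
    (hD : ∀ k, i ≤ k → k < j → ∀ᶠ s in 𝓝[>] (0 : ℝ),
      (Φ (x (k + 1) + s • v) - Φ (x (k + 1))) / s < D) :
    inner ℝ (x i - x j) v ≤ (j * h - i * h) * D := by
  induction j, hij using Nat.le_induction with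
  | base => simp
  | succ j hij ih =>
    have h1 := (hx j).inner_le hh (hD j hij (by omega))
    have h2 := ih fun k hk hk' => hD k hk (by omega)
    rw [← sub_add_sub_cancel (x i) (x j) (x (j + 1)), inner_add_left]
    push_cast
    linarith

theorem tendsto_floor_mul {h : ℕ → ℝ} (hpos : ∀ k, 0 < h k) (hlim : Tendsto h atTop (𝓝 0))
    {t : ℝ} (ht : 0 ≤ t) : Tendsto (fun k => ⌊t / h k⌋₊ * h k) atTop (𝓝 t) := by
  have h1 : Tendsto (fun k => t - h k) atTop (𝓝 t) := by simpa using tendsto_const_nhds.sub hlim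
  refine tendsto_of_tendsto_of_tendsto_of_le_of_le h1 tendsto_const_nhds (fun k => ?_) fun k => ?_
  · have h2 := Nat.lt_floor_add_one (t / h k)
    rw [div_lt_iff₀ (hpos k)] at h2
    linarith
  · exact (le_div_iff₀ (hpos k)).1 (Nat.floor_le (div_nonneg ht (hpos k).le))

/-- Gradient flows of nonnegative locally Lipschitz functions exist for all times. -/
theorem exists_isGradientFlow [FiniteDimensional ℝ E] {Φ : E → ℝ} (hΦ : Continuous Φ)
    (hLip : ∀ (x : E) (R : ℝ), ∃ K : NNReal, LipschitzOnWith K Φ (Metric.closedBall x R))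
    (h0 : ∀ x, 0 ≤ Φ x) {T : ℝ} (hT : 0 ≤ T) (θ₀ : E) : ∃ θ, IsGradientFlow Φ T θ₀ θ := by
  have : ProperSpace E := FiniteDimensional.proper_real E
  let h : ℕ → ℝ := fun k => 1 / (k + 1)
  have hpos : ∀ k, 0 < h k := fun k => Nat.one_div_pos_of_nat
  have hlim : Tendsto h atTop (𝓝 0) := tendsto_one_div_add_atTop_nhds_zero_nat
  choose prox hprox using fun k x => exists_isProxStep hΦ h0 (hpos k) x
  let x : ℕ → ℕ → E := fun k i => (prox k)^[i] θ₀
  have hx0 : ∀ k, x k 0 = θ₀ := fun k => rfl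
  have hx : ∀ k i, IsProxStep Φ (h k) (x k i) (x k (i + 1)) := fun k i => by
    simp only [x, Function.iterate_succ_apply']
    exact hprox k _
  obtain ⟨K, hK⟩ := hLip θ₀ (Φ θ₀ + T)
  have hball : ∀ k (i : ℕ), i * h k ≤ T → x k i ∈ Metric.closedBall θ₀ (Φ θ₀ + T) := fun k i hi => by
    have h1 := norm_sub_zero_le_of_isProxStep (hpos k) (hx k) i
    rw [hx0] at h1
    rw [mem_closedBall_iff_norm]
    linarith [h0 (x k i)]
  have hfloor : ∀ k, ∀ t ∈ Icc 0 T, ∀ i ≤ ⌊t / h k⌋₊, i * h k ≤ T := fun k t ht i hi =>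
    ((le_div_iff₀ (hpos k)).1 ((Nat.cast_le.2 hi).trans
      (Nat.floor_le (div_nonneg ht.1 (hpos k).le)))).trans ht.2
  -- A nonprincipal ultrafilter selects limits at all times simultaneously, in place of a diagonal
  -- subsequence.
  let 𝒰 : Ultrafilter ℕ := hyperfilter ℕ
  have h𝒰 : (𝒰 : Filter ℕ) ≤ atTop := Nat.hyperfilter_le_atTop
  have hex : ∀ t ∈ Icc 0 T, ∃ l, Tendsto (fun k => x k ⌊t / h k⌋₊) 𝒰 (𝓝 l) := fun t ht => by
    obtain ⟨l, -, hl⟩ := (isCompact_closedBall θ₀ (Φ θ₀ + T)).ultrafilter_le_nhds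
      (𝒰.map fun k => x k ⌊t / h k⌋₊)
      (by
        rw [le_principal_iff]
        exact Ultrafilter.mem_map.2 (univ_mem' fun k => hball k _ (hfloor k t ht _ le_rfl)))
    exact ⟨l, hl⟩
  choose! θ hθ using hex
  have hm : ∀ t ∈ Icc 0 T, Tendsto (fun k => ⌊t / h k⌋₊ * h k) 𝒰 (𝓝 t) := fun t ht =>
    (tendsto_floor_mul hpos hlim ht.1).mono_left h𝒰
  have hmono : ∀ k, ∀ {t t'}, t ≤ t' → ⌊t / h k⌋₊ ≤ ⌊t' / h k⌋₊ := fun k t t' htt =>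
    Nat.floor_mono (div_le_div_of_nonneg_right htt (hpos k).le)
  have hθLip : ∀ t ∈ Icc 0 T, ∀ t' ∈ Icc 0 T, t ≤ t' → ‖θ t' - θ t‖ ≤ 2 * K * (t' - t) := by
    intro t ht t' ht' htt
    refine le_of_tendsto_of_tendsto' ((hθ t' ht').sub (hθ t ht)).norm
      (((hm t' ht').sub (hm t ht)).const_mul (2 * (K : ℝ))) fun k => ?_
    exact norm_sub_le_of_isProxStep (hpos k) (hx k) hK (hmono k htt)
      fun i hi => hball k i (hfloor k t' ht' i hi)
  have hLipOn : LipschitzOnWith (2 * K) θ (Icc 0 T) := by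
    refine LipschitzOnWith.of_dist_le_mul fun t ht t' ht' => ?_
    rcases le_total t t' with htt | htt
    · rw [dist_comm, dist_eq_norm, dist_comm, Real.dist_eq, abs_of_nonneg (sub_nonneg.2 htt)]
      exact_mod_cast hθLip t ht t' ht' htt
    · rw [dist_eq_norm, Real.dist_eq, abs_of_nonneg (sub_nonneg.2 htt)]
      exact_mod_cast hθLip t' ht' t ht htt
  refine ⟨θ, ?_, ?_, ?_⟩
  · have h1 := hθ 0 ⟨le_rfl, hT⟩
    simp only [zero_div, Nat.floor_zero, hx0] at h1
    exact tendsto_nhds_unique h1 tendsto_const_nhds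
  · rw [← uIcc_of_le hT] at hLipOn
    exact hLipOn.absolutelyContinuousOnInterval
  rw [← Measure.restrict_congr_set (Ioo_ae_eq_Icc (a := (0 : ℝ)) (b := T)),
    ae_restrict_iff' measurableSet_Ioo]
  filter_upwards [hLipOn.ae_differentiableWithinAt_of_mem_real] with t ht1 ht
  have htI : t ∈ Icc 0 T := Ioo_subset_Icc_self ht
  have hd : HasDerivAt θ (deriv θ t) t :=
    ((ht1 htI).differentiableAt (Icc_mem_nhds ht.1 ht.2)).hasDerivAt
  refine ⟨_, hd, fun v => ?_⟩
  by_contra! hcon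
  -- `D` lies strictly between the Clarke directional derivative and `⟪-θ', v⟫`. Difference
  -- quotients near `θ t` are then below `D`; summing the optimality conditions and differentiating
  -- at `t` contradicts this.
  obtain ⟨D, hD1, hD2⟩ := EReal.lt_iff_exists_real_btwn.1 hcon
  have hev := eventually_lt_of_limsup_lt hD1
  obtain ⟨pa, hpa, pb, hpb, hab⟩ := Filter.eventually_prod_iff.1 hev
  obtain ⟨r, hr, hpar⟩ := Metric.eventually_nhds_iff_ball.1 hpa
  have hquot : ∀ z ∈ Metric.ball (θ t) r, ∀ᶠ s in 𝓝[>] (0 : ℝ), (Φ (z + s • v) - Φ z) / s < D :=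
    fun z hz => hpb.mono fun s hs => EReal.coe_lt_coe_iff.1 (hab (hpar z hz) hs)
  have hright : ∀ᶠ t' in 𝓝[>] t, inner ℝ (θ t - θ t') v ≤ (t' - t) * D := by
    have hcont : Tendsto (fun t' : ℝ => 2 * K * (t' - t)) (𝓝[>] t) (𝓝 0) := by
      have : Continuous fun t' : ℝ => 2 * K * (t' - t) := by fun_prop
      simpa using (this.tendsto t).mono_left nhdsWithin_le_nhds
    filter_upwards [Ioo_mem_nhdsGT ht.2, hcont.eventually (Iio_mem_nhds (half_pos hr))]
      with t' ht' hsmall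
    have htI' : t' ∈ Icc 0 T := ⟨htI.1.trans ht'.1.le, ht'.2.le⟩
    refine le_of_tendsto_of_tendsto (((hθ t htI).sub (hθ t' htI')).inner tendsto_const_nhds)
      (((hm t' htI').sub (hm t htI)).mul_const D) ?_
    -- Half of `r` is spent on the convergence at time `t`, the other half on the movement up to
    -- `t'`, so all intermediate iterates lie in the ball.
    have hsm : ∀ᶠ k in (𝒰 : Filter ℕ),
        2 * (K : ℝ) * (⌊t' / h k⌋₊ * h k - ⌊t / h k⌋₊ * h k) < r / 2 :=
      (((hm t' htI').sub (hm t htI)).const_mul (2 * (K : ℝ))).eventually (Iio_mem_nhds hsmall)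
    filter_upwards [hsm, (hθ t htI).eventually (Metric.ball_mem_nhds _ (half_pos hr))]
      with k hk1 (hk2 : x k ⌊t / h k⌋₊ ∈ Metric.ball (θ t) (r / 2))
    refine inner_le_of_isProxStep (hpos k) (hx k) (hmono k ht'.1.le) fun i hi hi' => ?_
    refine hquot _ ?_
    have h1 := norm_sub_le_of_isProxStep (hpos k) (hx k) hK (Nat.le_succ_of_le hi)
      fun j hj => hball k j (hfloor k t' htI' j (hj.trans hi'))
    have h2 : (((i + 1 : ℕ) : ℝ)) * h k ≤ ⌊t' / h k⌋₊ * h k :=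
      mul_le_mul_of_nonneg_right (Nat.cast_le.2 hi') (hpos k).le
    have h3 : 2 * (K : ℝ) * (((i + 1 : ℕ) : ℝ) * h k - ⌊t / h k⌋₊ * h k) ≤
        2 * (K : ℝ) * (⌊t' / h k⌋₊ * h k - ⌊t / h k⌋₊ * h k) := by gcongr
    have h4 := norm_sub_le_norm_sub_add_norm_sub (x k (i + 1)) (x k ⌊t / h k⌋₊) (θ t)
    rw [Metric.mem_ball, dist_eq_norm] at hk2 ⊢
    rw [Nat.succ_eq_add_one] at h1
    linarith
  have hslope : Tendsto (slope (fun τ => inner ℝ (-θ τ) v) t) (𝓝[>] t)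
      (𝓝 (inner ℝ (-deriv θ t) v)) := by
    have h1 : HasDerivAt (fun τ => inner ℝ (-θ τ) v) (inner ℝ (-deriv θ t) v) t := by
      simpa using hd.neg.inner ℝ (hasDerivAt_const t v)
    exact (hasDerivAt_iff_tendsto_slope.1 h1).mono_left
      (nhdsWithin_mono t (fun y (hy : t < y) => hy.ne'))
  have hle : inner ℝ (-deriv θ t) v ≤ D := by
    refine le_of_tendsto hslope ?_
    filter_upwards [hright, self_mem_nhdsWithin] with t' h1 (h2 : t < t')
    rw [slope_def_field, div_le_iff₀ (sub_pos.2 h2), ← inner_sub_left]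
    rw [show -θ t' - -θ t = θ t - θ t' by abel]
    linarith
  exact absurd (EReal.coe_lt_coe_iff.1 hD2) (not_lt.2 hle)

end Existence

/-! ### Exponential decay from a quadratic direction -/

section LinearConvergence

/-- A gradient flow converges linearly on bounded time intervals if the objective is quadratic in
some direction, with nonzero slope at the initial point. -/
theorem IsGradientFlow.exists_exp_decay {E : Type} [NormedAddCommGroup E] [InnerProductSpace ℝ E]
    [FiniteDimensional ℝ E] {Φ : E → ℝ} (hΦ : IsPC1 Φ) (hnonneg : ∀ x, 0 ≤ Φ x) {T : ℝ}
    (hT : 0 < T) {θ₀ : E} {θ : ℝ → E} (h : IsGradientFlow Φ T θ₀ θ) {G : E → ℝ}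
    (hG : Continuous G) {w : E} (hw : ‖w‖ = 1) {q : ℝ}
    (hq : ∀ z s, Φ (z + s • w) = Φ z + s * G z + s ^ 2 * q) (hG₀ : G θ₀ ≠ 0) :
    ∃ lam : ℝ, 0 < lam ∧ ∀ t ∈ Icc 0 T, Φ (θ t) ≤ Real.exp (-2 * lam * t) * Φ (θ 0) := by
  obtain ⟨hac, hdis⟩ := h.dissipation hΦ hT.le
  obtain ⟨hθ0, hθac, -⟩ := h
  have hcont : ContinuousOn (fun t => |G (θ t)|) (Icc 0 T) := by
    have := hθac.continuousOn
    rw [uIcc_of_le hT.le] at this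
    exact (hG.comp_continuousOn this).abs
  have hpos : 0 < |G θ₀| := abs_pos.2 hG₀
  set c := |G θ₀| / 2 with hc
  have hc0 : 0 < c := half_pos hpos
  obtain ⟨ε, hε0, hεT, hε⟩ : ∃ ε, 0 < ε ∧ ε ≤ T ∧ ∀ t ∈ Icc 0 ε, c ≤ |G (θ t)| := by
    have h1 : ∀ᶠ t in 𝓝[Icc 0 T] 0, c < |G (θ t)| :=
      (hcont 0 (left_mem_Icc.2 hT.le)).eventually (Ioi_mem_nhds (by simp only [hθ0]; linarith))
    rw [eventually_nhdsWithin_iff, Metric.eventually_nhds_iff] at h1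
    obtain ⟨δ, hδ, h1⟩ := h1
    refine ⟨min T (δ / 2), by positivity, min_le_left _ _, fun t ht => ?_⟩
    refine (h1 ?_ ⟨ht.1, ht.2.trans (min_le_left _ _)⟩).le
    rw [Real.dist_eq, sub_zero, abs_of_nonneg ht.1]
    linarith [ht.2, min_le_right T (δ / 2)]
  have hmono : ∀ {a b κ : ℝ}, 0 ≤ a → a ≤ b → b ≤ T → (∀ t ∈ Icc a b, κ ≤ G (θ t) ^ 2) →
      Φ (θ b) ≤ Φ (θ a) - κ * (b - a) := by
    intro a b κ ha hab hb hκ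
    have hsub : Icc a b ⊆ Icc 0 T := Icc_subset_Icc ha hb
    refine AbsolutelyContinuousOnInterval.le_sub_of_deriv_le (g := fun t => Φ (θ t)) hab
      (hac.mono (by rwa [uIcc_of_le hab, uIcc_of_le hT.le])) ?_
    filter_upwards [ae_restrict_of_ae_restrict_of_subset hsub hdis,
      ae_restrict_mem measurableSet_Icc] with t ⟨ξ, hξ, hd⟩ ht
    have h1 := abs_real_inner_le_norm ξ w
    rw [inner_eq_of_mem_clarkeGradient hG hq hξ, hw, mul_one] at h1
    have h2 := hκ t ht
    have h3 : |G (θ t)| ^ 2 ≤ ‖ξ‖ ^ 2 := by gcongr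
    rw [sq_abs] at h3
    linarith
  have hc2 : ∀ t ∈ Icc 0 ε, c ^ 2 ≤ G (θ t) ^ 2 := fun t ht => by
    rw [← sq_abs (G _)]
    gcongr
    exact hε t ht
  -- The total drop `c² ε` gained on `[0, ε]` is spread over `[0, T]`; this is where the dependence
  -- on `T` enters.
  have hlin : ∀ t ∈ Icc 0 T, Φ (θ t) ≤ Φ (θ 0) - c ^ 2 * ε / T * t := by
    intro t ht
    have hεT' : ε / T ≤ 1 := div_le_one_of_le₀ hεT hT.le
    rcases le_total t ε with hle | hle
    · have h1 := hmono le_rfl ht.1 ht.2 fun τ hτ => hc2 τ ⟨hτ.1, hτ.2.trans hle⟩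
      have h2 : c ^ 2 * ε / T * t ≤ c ^ 2 * t := by
        rw [mul_div_assoc]
        exact mul_le_mul_of_nonneg_right
          (mul_le_of_le_one_right (sq_nonneg c) hεT') ht.1
      linarith
    · have h1 := hmono le_rfl hε0.le hεT hc2
      have h2 := hmono (κ := 0) hε0.le hle ht.2 fun τ _ => sq_nonneg _
      have h3 : c ^ 2 * ε / T * t ≤ c ^ 2 * ε := by
        rw [div_mul_eq_mul_div]
        exact div_le_of_le_mul₀ hT.le (by positivity)
          (mul_le_mul_of_nonneg_left ht.2 (by positivity))
      linarith
  set κ := c ^ 2 * ε / T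
  have hκ : 0 < κ := by positivity
  -- The loss falls by at least `κ T` and stays nonnegative, so it was positive at the start.
  have hΦ0 : 0 < Φ (θ 0) := by
    have h1 := hlin T (right_mem_Icc.2 hT.le)
    have h2 : 0 < κ * T := by positivity
    linarith [hnonneg (θ T)]
  -- Chosen so that `1 + x ≤ exp x` at `x = -κ t / Φ (θ 0)` matches the linear bound.
  refine ⟨κ / (2 * Φ (θ 0)), by positivity, fun t ht => (hlin t ht).trans ?_⟩
  have h1 := Real.add_one_le_exp (-2 * (κ / (2 * Φ (θ 0))) * t)
  have h2 := mul_le_mul_of_nonneg_right h1 hΦ0.le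
  have h3 : (-2 * (κ / (2 * Φ (θ 0))) * t + 1) * Φ (θ 0) = Φ (θ 0) - κ * t := by
    field_simp
    ring
  linarith

variable {n : ℕ} {𝒳 κ I O : Type} [Fintype O]

theorem loss_eq_sum (f : 𝒳 → EuclideanSpace ℝ I → O → ℝ) (X : Fin n → 𝒳) (y : Fin n → O → ℝ)
    (θ : EuclideanSpace ℝ I) :
    loss f X y θ = 1 / 2 * ∑ j, ∑ a, (f (X j) θ a - y j a) ^ 2 := by
  simp [loss, EuclideanSpace.norm_sq_eq]

theorem sq_norm_labels_sub_predictions (f : 𝒳 → EuclideanSpace ℝ I → O → ℝ) (X : Fin n → 𝒳)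
    (y : Fin n → O → ℝ) (θ : EuclideanSpace ℝ I) :
    ‖labels y - predictions f X θ‖ ^ 2 = 2 * loss f X y θ := by
  rw [loss_eq_sum, EuclideanSpace.norm_sq_eq, Fintype.sum_prod_type]
  simp only [labels, predictions, PiLp.sub_apply, Real.norm_eq_abs, sq_abs]
  rw [← mul_assoc]
  norm_num
  exact Finset.sum_congr rfl fun j _ => Finset.sum_congr rfl fun a _ => sub_sq_comm _ _

theorem loss_nonneg (f : 𝒳 → EuclideanSpace ℝ I → O → ℝ) (X : Fin n → 𝒳) (y : Fin n → O → ℝ)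
    (θ : EuclideanSpace ℝ I) : 0 ≤ loss f X y θ := by
  rw [loss_eq_sum]
  positivity

theorem isPC1_loss [Fintype I] {f : 𝒳 → EuclideanSpace ℝ I → O → ℝ} {X : Fin n → 𝒳}
    (hf : ∀ j a, IsPC1 fun θ => f (X j) θ a) (y : Fin n → O → ℝ) : IsPC1 (loss f X y) := by
  have h1 : loss f X y = fun θ => 1 / 2 * ∑ j, ∑ a,
      (f (X j) θ a + -y j a) * (f (X j) θ a + -y j a) := by
    ext θ
    simp only [loss_eq_sum, sq, sub_eq_add_neg]
  rw [h1]
  refine (IsPC1.const _).mul (IsPC1.sum _ fun j _ => IsPC1.sum _ fun a _ => ?_)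
  exact ((hf j a).add (IsPC1.const _)).mul ((hf j a).add (IsPC1.const _))

/-- The loss is quadratic along a parameter that acts as a bias on one component of the output. -/
theorem loss_add_smul [DecidableEq O] {f : 𝒳 → EuclideanSpace ℝ I → O → ℝ}
    {w : EuclideanSpace ℝ I} {o : O}
    (hw : ∀ x θ (s : ℝ), f x (θ + s • w) = f x θ + s • Pi.single o (1 : ℝ)) (X : Fin n → 𝒳)
    (y : Fin n → O → ℝ) (θ : EuclideanSpace ℝ I) (s : ℝ) :
    loss f X y (θ + s • w) =
      loss f X y θ + s * (∑ j, (f (X j) θ o - y j o)) + s ^ 2 * (n / 2) := by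
  have h1 : ∀ j, ∑ a, (f (X j) (θ + s • w) a - y j a) ^ 2 =
      ∑ a, (f (X j) θ a - y j a) ^ 2 + (2 * s * (f (X j) θ o - y j o) + s ^ 2) := by
    intro j
    have h2 : ∀ a, (f (X j) (θ + s • w) a - y j a) ^ 2 = (f (X j) θ a - y j a) ^ 2 +
        if a = o then 2 * s * (f (X j) θ o - y j o) + s ^ 2 else 0 := by
      intro a
      rw [hw]
      by_cases h : a = o
      · subst h
        simp
        ring
      · simp [h]
    simp_rw [h2, Finset.sum_add_distrib, Finset.sum_ite_eq', Finset.mem_univ, if_true]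
  simp_rw [loss_eq_sum, h1, Finset.sum_add_distrib, ← Finset.mul_sum]
  simp
  ring

/-- Linear convergence for models with piecewise `C¹` outputs and an output bias. -/
theorem convergesLinearly_of_bias [Fintype κ] [Fintype I] [DecidableEq I] [DecidableEq O]
    {f : (κ → ℝ) → EuclideanSpace ℝ I → O → ℝ}
    (hf : ∀ a, IsPC1 fun p : EuclideanSpace ℝ I × (κ → ℝ) => f p.2 p.1 a)
    (hb : n = 0 ∨ IsEmpty O ∨ ∃ i o, ∀ x θ (s : ℝ),
      f x (θ + s • EuclideanSpace.single i (1 : ℝ)) = f x θ + s • Pi.single o (1 : ℝ))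
    (y : Fin n → O → ℝ) {μ : Measure (EuclideanSpace ℝ I × (Fin n → κ → ℝ))}
    (hμ : μ ≪ volume) : ConvergesLinearly f y μ := by
  have hpc : ∀ X : Fin n → κ → ℝ, IsPC1 (loss f X y) := fun X =>
    isPC1_loss (fun j a => (hf a).comp_contDiff (u := fun θ => (θ, X j)) (by fun_prop)) y
  have hex : ∀ (X : Fin n → κ → ℝ) (θ₀ : EuclideanSpace ℝ I) (T : ℝ), 0 < T →
      ∃ θ, IsGradientFlow (loss f X y) T θ₀ θ := fun X θ₀ T hT =>
    exists_isGradientFlow (hpc X).1 (hpc X).exists_lipschitzOnWith (loss_nonneg f X y) hT.le θ₀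
  have hnorm : ∀ {X : Fin n → κ → ℝ} {θ θ' : EuclideanSpace ℝ I} {lam t : ℝ},
      loss f X y θ ≤ Real.exp (-2 * lam * t) * loss f X y θ' →
      ‖labels y - predictions f X θ‖ ≤ Real.exp (-lam * t) * ‖labels y - predictions f X θ'‖ := by
    intro X θ θ' lam t h
    refine le_of_sq_le_sq ?_ (by positivity)
    rw [mul_pow, sq_norm_labels_sub_predictions, sq_norm_labels_sub_predictions, ← Real.exp_nat_mul]
    have : ((2 : ℕ) : ℝ) * (-lam * t) = -2 * lam * t := by push_cast; ring
    rw [this]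
    linarith
  suffices h : ∀ᵐ p ∂μ, ∀ T : ℝ, 0 < T → ∀ θ, IsGradientFlow (loss f p.2 y) T p.1 θ →
      ∃ lam : ℝ, 0 < lam ∧ ∀ t ∈ Icc 0 T,
        loss f p.2 y (θ t) ≤ Real.exp (-2 * lam * t) * loss f p.2 y (θ 0) by
    filter_upwards [h] with p hp T hT
    refine ⟨hex p.2 p.1 T hT, fun θ hθ => ?_⟩
    obtain ⟨lam, hlam, hdecay⟩ := hp T hT θ hθ
    exact ⟨lam, hlam, fun t ht => ⟨hnorm (hdecay t ht), hdecay t ht⟩⟩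
  have hzero : n = 0 ∨ IsEmpty O → ∀ X θ, loss f X y θ = 0 := by
    rintro (rfl | hO) X θ <;> simp [loss_eq_sum]
  rw [← or_assoc] at hb
  rcases hb with hb | ⟨i, o, hio⟩
  · exact Eventually.of_forall fun p T _ θ _ => ⟨1, one_pos, fun t _ => by simp [hzero hb]⟩
  by_cases hn : n = 0
  · exact Eventually.of_forall fun p T _ θ _ =>
      ⟨1, one_pos, fun t _ => by simp [hzero (Or.inl hn)]⟩
  let G : EuclideanSpace ℝ I × (Fin n → κ → ℝ) → ℝ := fun p => ∑ j, (f (p.2 j) p.1 o - y j o)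
  have hG : Continuous G := continuous_finsetSum _ fun j _ =>
    ((hf o).1.comp (f := fun p : EuclideanSpace ℝ I × (Fin n → κ → ℝ) => (p.1, p.2 j))
      (by fun_prop)).sub continuous_const
  have hG0 : ∀ᵐ p, G p ≠ 0 := by
    let L : ℝ →ₗ[ℝ] EuclideanSpace ℝ I × (Fin n → κ → ℝ) :=
      (LinearMap.id.smulRight (EuclideanSpace.single i (1 : ℝ))).prod 0
    have hHaar : (volume : Measure (EuclideanSpace ℝ I × (Fin n → κ → ℝ))).IsAddHaarMeasure :=
      have hpi : (volume : Measure (Fin n → κ → ℝ)).IsAddHaarMeasure :=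
        Measure.pi.isAddHaarMeasure _
      Measure.prod.instIsAddHaarMeasure _ _
    -- By disintegration along the bias direction it is enough to look at one line at a time, where
    -- `G` is affine with slope `n ≠ 0` and has a single zero.
    refine ae_mem_of_ae_add_linearMap_mem L volume volume (s := {p | G p ≠ 0})
      (isOpen_ne_fun hG continuous_const).measurableSet fun p => ?_
    have hline : ∀ s, G (p + L s) = G p + n * s := fun s => by
      have hL : p + L s = (p.1 + s • EuclideanSpace.single i (1 : ℝ), p.2) :=
        Prod.ext rfl (add_zero p.2)
      rw [hL]
      simp only [G, hio, Pi.add_apply, Pi.smul_apply, Pi.single_eq_same, smul_eq_mul, mul_one,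
        Finset.sum_sub_distrib, Finset.sum_add_distrib, Finset.sum_const, Finset.card_univ,
        Fintype.card_fin, nsmul_eq_mul]
      ring
    filter_upwards [(countable_singleton (-G p / n)).ae_notMem volume] with s hs
    change G (p + L s) ≠ 0
    rw [hline]
    contrapose! hs
    rw [mem_singleton_iff, eq_div_iff (Nat.cast_ne_zero.2 hn)]
    linarith
  filter_upwards [hμ.ae_le hG0] with p hp T hT θ hθ
  exact hθ.exists_exp_decay (hpc p.2) (loss_nonneg f p.2 y) hT (G := fun z => G (z, p.2))
    (by fun_prop) (by simp) (loss_add_smul hio p.2 y) hp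

end LinearConvergence

/-! ### The three architectures -/

section Networks

/-- The state of a layered network after `k` layers, before applying the activation. -/
def layerState {L : ℕ} {ι : Fin (L + 1) → Type} (σ : ℝ → ℝ)
    (g : ∀ i : Fin L, (ι i.castSucc → ℝ) → ι i.succ → ℝ) (x : ι 0 → ℝ) (k : Fin (L + 1)) :
    ι k → ℝ :=
  Fin.induction (motive := fun k => ι k → ℝ) x
    (fun i h => g i (if (i : ℕ) = 0 then h else fun a => σ (h a))) k

theorem layerState_succ {L : ℕ} {ι : Fin (L + 1) → Type} (σ : ℝ → ℝ)
    (g : ∀ i : Fin L, (ι i.castSucc → ℝ) → ι i.succ → ℝ) (x : ι 0 → ℝ) (i : Fin L) :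
    layerState σ g x i.succ = g i (if (i : ℕ) = 0 then layerState σ g x i.castSucc
      else fun a => σ (layerState σ g x i.castSucc a)) :=
  rfl

/-- `Z` will be the product of parameters and inputs: regularity in the parameters serves the flow,
joint continuity the measurability of the exceptional set. -/
theorem isPC1_composeLayers {Z : Type*} [NormedAddCommGroup Z] [NormedSpace ℝ Z] {L : ℕ}
    {ι : Fin (L + 1) → Type} {σ : ℝ → ℝ} (hσ : IsPC1 σ)
    {g : Z → ∀ i : Fin L, (ι i.castSucc → ℝ) → ι i.succ → ℝ}
    (hg : ∀ i (h : Z → ι i.castSucc → ℝ), (∀ b, IsPC1 fun z => h z b) →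
      ∀ a, IsPC1 fun z => g z i (h z) a)
    {x : Z → ι 0 → ℝ} (hx : ∀ b, IsPC1 fun z => x z b) (a : ι (Fin.last L)) :
    IsPC1 fun z => composeLayers σ (g z) (x z) a := by
  suffices h : ∀ k a, IsPC1 fun z => layerState σ (g z) (x z) k a from h (Fin.last L) a
  intro k
  induction k using Fin.induction with
  | zero => exact hx
  | succ i ih =>
    simp only [layerState_succ]
    refine hg i (fun z => if (i : ℕ) = 0 then layerState σ (g z) (x z) i.castSucc
      else fun a => σ (layerState σ (g z) (x z) i.castSucc a)) fun b => ?_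
    split_ifs
    · exact ih b
    · exact hσ.comp (ih b)

/-- A change of the bias of the last layer translates the output. -/
theorem composeLayers_add_bias {L : ℕ} {ι : Fin (L + 1 + 1) → Type} (σ : ℝ → ℝ)
    {g g' : ∀ i : Fin (L + 1), (ι i.castSucc → ℝ) → ι i.succ → ℝ} {d : ι (Fin.last (L + 1)) → ℝ}
    (hg : ∀ i : Fin L, g' i.castSucc = g i.castSucc)
    (hlast : ∀ h (a : ι (Fin.last (L + 1))), g' (Fin.last L) h a = g (Fin.last L) h a + d a)
    (x : ι 0 → ℝ) :
    composeLayers σ g' x = composeLayers σ g x + d := by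
  have h : ∀ k : Fin (L + 1), layerState σ g' x k.castSucc = layerState σ g x k.castSucc := by
    intro k
    induction k using Fin.induction with
    | zero => rfl
    | succ i ih =>
      change layerState σ g' x i.castSucc.succ = layerState σ g x i.castSucc.succ
      rw [layerState_succ, layerState_succ, ih, hg]
  ext a
  change layerState σ g' x (Fin.last L).succ a = layerState σ g x (Fin.last L).succ a + d a
  rw [layerState_succ, layerState_succ, h, hlast]

theorem isPC1_activation {σ : ℝ → ℝ}
    (hσ : IsPiecewiseNonzeroPolynomial σ ∨ σ = relu ∨ σ = Real.sigmoid) : IsPC1 σ := by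
  rcases hσ with ⟨hc, ⟨k, C, p, -, hC, hp⟩, -⟩ | rfl | rfl
  · refine ⟨hc, range fun i x => (p i).eval x, finite_range _, ?_, fun x => ?_⟩
    · rintro _ ⟨i, rfl⟩
      simpa using (p i).contDiff_aeval (𝕜 := ℝ) 1
    · obtain ⟨i, hi⟩ := mem_iUnion.1 (hC ▸ mem_univ x)
      exact ⟨_, mem_range_self i, hp i x hi⟩
  · refine ⟨continuous_id.max continuous_const, {id, fun _ => 0}, toFinite _, ?_, fun x => ?_⟩
    · rintro _ (rfl | rfl)
      exacts [contDiff_id, contDiff_const]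
    · rcases le_total x 0 with h | h <;> simp [relu, h]
  · exact IsPC1.of_contDiff (contDiff_sigmoid.of_le le_top)

theorem isPC1_param {I κ : Type} [Fintype I] [Fintype κ] (i : I) :
    IsPC1 fun p : EuclideanSpace ℝ I × (κ → ℝ) => p.1 i :=
  IsPC1.of_contDiff (by fun_prop)

theorem isPC1_input {I κ : Type} [Fintype I] [Fintype κ] (b : κ) :
    IsPC1 fun p : EuclideanSpace ℝ I × (κ → ℝ) => p.2 b :=
  IsPC1.of_contDiff (by fun_prop)

theorem convergesLinearly_dnn {σ : ℝ → ℝ} (hσ : IsPC1 σ) {L n : ℕ} {N : Fin (L + 1) → ℕ}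
    (hN : n * N (Fin.last L) ≤ ∑ i : Fin L, N i.succ * (N i.castSucc + 1))
    (y : Fin n → Fin (N (Fin.last L)) → ℝ)
    {μ : Measure (EuclideanSpace ℝ (DNNIndex N) × (Fin n → Fin (N 0) → ℝ))} (hμ : μ ≪ volume) :
    ConvergesLinearly (dnn N σ) y μ := by
  refine convergesLinearly_of_bias (fun a => ?_) ?_ y hμ
  · refine isPC1_composeLayers (ι := fun k => Fin (N k)) hσ (fun i h hh a => ?_) isPC1_input a
    exact (IsPC1.sum _ fun b _ => (isPC1_param _).mul (hh b)).add (isPC1_param _)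
  · rcases L with - | L
    -- Without layers there is no bias, but the parameter count is 0 and forces `n = 0` or an empty
    -- output; the loss is then identically 0.
    · simp only [Finset.univ_eq_empty, Finset.sum_empty, nonpos_iff_eq_zero, mul_eq_zero] at hN
      exact hN.imp_right fun h => Or.inl (by rw [h]; infer_instance)
    refine Or.inr ((isEmpty_or_nonempty _).imp_right fun ⟨o⟩ => ?_)
    refine ⟨⟨Fin.last L, Sum.inr o⟩, o, fun x θ s => ?_⟩
    refine composeLayers_add_bias (ι := fun k => Fin (N k)) σ (fun i => ?_) (fun h a => ?_) x
    · ext h a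
      simp [Fin.castSucc_ne_last]
    · simp [Pi.single_apply, add_assoc]

theorem convergesLinearly_resNet {σ : ℝ → ℝ} (hσ : IsPC1 σ) {L n N : ℕ}
    (hN : n * N ≤ L * (N ^ 2 + N)) (y : Fin n → Fin N → ℝ)
    {μ : Measure (EuclideanSpace ℝ (ResNetIndex L N) × (Fin n → Fin N → ℝ))} (hμ : μ ≪ volume) :
    ConvergesLinearly (resNet L N σ) y μ := by
  refine convergesLinearly_of_bias (fun a => ?_) ?_ y hμ
  · refine isPC1_composeLayers (ι := fun _ => Fin N) hσ (fun i h hh a => ?_) isPC1_input a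
    exact ((hh a).add (IsPC1.sum _ fun b _ => (isPC1_param _).mul (hh b))).add (isPC1_param _)
  · rcases L with - | L
    · simp only [zero_mul, nonpos_iff_eq_zero, mul_eq_zero] at hN
      exact hN.imp_right fun h => Or.inl (by rw [h]; infer_instance)
    refine Or.inr ((isEmpty_or_nonempty _).imp_right fun ⟨o⟩ => ?_)
    refine ⟨(Fin.last L, Sum.inr o), o, fun x θ s => ?_⟩
    refine composeLayers_add_bias (ι := fun _ => Fin N) σ (fun i => ?_) (fun h a => ?_) x
    · ext h a
      simp [Fin.castSucc_ne_last]
    · simp [Pi.single_apply, add_assoc]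

theorem convergesLinearly_gcn {σ : ℝ → ℝ} (hσ : IsPC1 σ) {L n m : ℕ} (G : SimpleGraph (Fin m))
    [DecidableRel G.Adj] (s : ℝ) {N : Fin (L + 1) → ℕ}
    (hN : n * (m * N (Fin.last L)) ≤ ∑ i : Fin L, N i.succ * (N i.castSucc + m))
    (y : Fin n → Fin m × Fin (N (Fin.last L)) → ℝ)
    {μ : Measure (EuclideanSpace ℝ (GCNIndex m N) × (Fin n → Fin m × Fin (N 0) → ℝ))}
    (hμ : μ ≪ volume) : ConvergesLinearly (gcn G s N σ) y μ := by
  refine convergesLinearly_of_bias (fun a => ?_) ?_ y hμ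
  · refine isPC1_composeLayers (ι := fun k => Fin m × Fin (N k)) hσ (fun i h hh a => ?_)
      isPC1_input a
    simp only [Matrix.mul_apply, Matrix.of_apply]
    exact (IsPC1.sum _ fun b _ => (IsPC1.sum _ fun u _ => (IsPC1.const _).mul (hh _)).mul
      (isPC1_param _)).add (isPC1_param _)
  · rcases L with - | L
    · simp only [Finset.univ_eq_empty, Finset.sum_empty, nonpos_iff_eq_zero, mul_eq_zero] at hN
      refine hN.imp_right fun h => Or.inl ?_
      rw [← Fintype.card_eq_zero_iff]
      simpa using h
    refine Or.inr ((isEmpty_or_nonempty _).imp_right fun ⟨o⟩ => ?_)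
    refine ⟨⟨Fin.last L, Sum.inr o⟩, o, fun x θ s => ?_⟩
    refine composeLayers_add_bias (ι := fun k => Fin m × Fin (N k)) σ (fun i => ?_) (fun h a => ?_) x
    · ext h a
      simp [Fin.castSucc_ne_last]
    · simp [Pi.single_apply, add_assoc]

end Networks

end NNFlow

theorem mainTheorem6 (σ : ℝ → ℝ)
    (hσ : NNFlow.IsPiecewiseNonzeroPolynomial σ ∨ σ = NNFlow.relu ∨ σ = Real.sigmoid)
    (L n : ℕ) :
    -- fully connected networks
    (∀ N : Fin (L + 1) → ℕ,
      n * N (Fin.last L) ≤ ∑ i : Fin L, N i.succ * (N i.castSucc + 1) →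
      ∀ (y : Fin n → Fin (N (Fin.last L)) → ℝ)
        (μ : MeasureTheory.Measure
          (EuclideanSpace ℝ (NNFlow.DNNIndex N) × (Fin n → Fin (N 0) → ℝ))),
        MeasureTheory.IsProbabilityMeasure μ →
        MeasureTheory.Measure.AbsolutelyContinuous μ MeasureTheory.volume →
        NNFlow.ConvergesLinearly (NNFlow.dnn N σ) y μ) ∧
    -- residual networks
    (∀ N : ℕ,
      n * N ≤ L * (N ^ 2 + N) →
      ∀ (y : Fin n → Fin N → ℝ)
        (μ : MeasureTheory.Measure
          (EuclideanSpace ℝ (NNFlow.ResNetIndex L N) × (Fin n → Fin N → ℝ))),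
        MeasureTheory.IsProbabilityMeasure μ →
        MeasureTheory.Measure.AbsolutelyContinuous μ MeasureTheory.volume →
        NNFlow.ConvergesLinearly (NNFlow.resNet L N σ) y μ) ∧
    -- graph convolutional networks
    (∀ (m : ℕ) (G : SimpleGraph (Fin m)) (_ : DecidableRel G.Adj) (s : ℝ)
        (N : Fin (L + 1) → ℕ),
      n * (m * N (Fin.last L)) ≤ ∑ i : Fin L, N i.succ * (N i.castSucc + m) →
      ∀ (y : Fin n → Fin m × Fin (N (Fin.last L)) → ℝ)
        (μ : MeasureTheory.Measure
          (EuclideanSpace ℝ (NNFlow.GCNIndex m N) × (Fin n → Fin m × Fin (N 0) → ℝ))),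
        MeasureTheory.IsProbabilityMeasure μ →
        MeasureTheory.Measure.AbsolutelyContinuous μ MeasureTheory.volume →
        NNFlow.ConvergesLinearly (NNFlow.gcn G s N σ) y μ) := by
  have h := NNFlow.isPC1_activation hσ
  exact ⟨fun _ hN y _ _ hμ => NNFlow.convergesLinearly_dnn h hN y hμ,
    fun _ hN y _ _ hμ => NNFlow.convergesLinearly_resNet h hN y hμ,
    fun _ G _ s _ hN y _ _ hμ => NNFlow.convergesLinearly_gcn h G s hN y hμ⟩
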